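/- Let $n>1$ be an integer and let $\zeta\in\mathbb{C}$ be a primitive $n$-th root of unity. For a positive integer $m$, let $D(m)$ be the set of derangements of $\{1,\dots,m\}$, i.e. permutations $\tau$ with $\tau(j)\neq j$ for all $j=1,\dots,m$. If $n$ is even, then $$\sum_{\tau\in D(n)}\prod_{j=1}^{n}\frac{1}{1-\zeta^{j-\tau(j)}}=\frac{((n-1)!!)^2}{2^n}=\frac{n!}{4^n}\binom{n}{n/2}.$$ If $n$ is odd, then $$\sum_{\tau\in D(n-1)}\prod_{j=1}^{n-1}\frac{1}{1-\zeta^{j-\tau(j)}}=\frac{1}{n}\left(\left(\frac{n-1}{2}\right)!\right)^2.$$ -/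

import Mathlib

/-- `derangementSum ζ m` is the sum over all derangements `τ` of `m` indices of the product
over all indices `j` of `1 / (1 - ζ ^ (j - τ j))`, with an integer exponent. The indices are
`0, …, m - 1`; only their differences matter, so this is the sum over `1, …, m`. -/
noncomputable def derangementSum (ζ : ℂ) (m : ℕ) : ℂ :=
  ∑ τ : derangements (Fin m),
    ∏ j : Fin m, 1 / (1 - ζ ^ (((j : ℕ) : ℤ) - (((τ : Equiv.Perm (Fin m)) j : ℕ) : ℤ)))

/-!
If `x` is injective on an index set of size `2 * m`, then the determinant of the matrix
`1 / (x i - x j)`, with zero diagonal, is `(-1) ^ m` times its permanent: removing one point gives,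
by telescoping partial fractions, a recursion which is the same for both up to a sign. With
`x j = ζ ^ j` this reduces the sum over derangements to a determinant.

For a primitive `n`-th root of unity `ζ` the `n × n` matrix `1 / (1 - ζ ^ (j - l))` is circulant.
Consecutive eigenvalues differ by one and their sum, the trace, is zero, so they are
`(n - 1) / 2 - k` for `k < n`. For even `n` the determinant is their product. For odd `n` one
eigenvalue is zero, and `n` times the minor of size `n - 1` is the trace of the adjugate, i.e. the
product of the other eigenvalues.
-/

open Equiv Equiv.Perm Finset Matrix

section SignImmanant

variable {α R : Type*} [Fintype α] [DecidableEq α] [CommRing R]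

/-- The immanant of `M` for the linear character `χ ∘ sign` of the symmetric group. It is the
permanent for trivial `χ` and the determinant for the inclusion of the signs in `R`, so that
results on both can be proved at once. -/
def signImmanant (χ : ℤˣ →* R) (M : Matrix α α R) : R :=
  ∑ σ : Perm α, χ (sign σ) * ∏ a, M (σ a) a

theorem signImmanant_one (M : Matrix α α R) : signImmanant 1 M = M.permanent := by
  simp only [signImmanant, permanent, MonoidHom.one_apply, one_mul]

theorem signImmanant_intCast (M : Matrix α α R) :
    signImmanant ((Int.castRingHom R : ℤ →* R).comp (Units.coeHom ℤ)) M = M.det := by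
  rw [det_apply']
  rfl

theorem signImmanant_submatrix_equiv_self {β : Type*} [Fintype β] [DecidableEq β]
    (χ : ℤˣ →* R) (M : Matrix α α R) (e : β ≃ α) :
    signImmanant χ (M.submatrix e e) = signImmanant χ M := by
  refine Fintype.sum_equiv e.permCongr _ _ fun σ => ?_
  rw [sign_permCongr]
  congr 1
  exact Fintype.prod_equiv e _ _ fun a => by simp [permCongr_apply]

theorem signImmanant_mul_diagonal (χ : ℤˣ →* R) (M : Matrix α α R) (d : α → R) :
    signImmanant χ (M * diagonal d) = signImmanant χ M * ∏ a, d a := by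
  simp only [signImmanant, mul_diagonal, prod_mul_distrib, sum_mul, mul_assoc]

theorem sum_filter_fixing_eq_signImmanant (χ : ℤˣ →* R) (M : Matrix α α R) (b : α) :
    ∑ σ : Perm α with σ b = b, χ (sign σ) * ∏ a ∈ univ.erase b, M (σ a) a =
      signImmanant χ (M.submatrix ((↑) : {a // a ≠ b} → α) (↑)) := by
  symm
  refine sum_bij (fun σ _ => ofSubtype σ) (fun σ _ => ?_) (fun _ _ _ _ h => ofSubtype_injective h)
    (fun σ hσ => ?_) (fun σ _ => ?_)
  · simp [ofSubtype_apply_of_not_mem]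
  · have hb : σ b = b := (mem_filter.1 hσ).2
    have hne (a : α) : σ a ≠ b ↔ a ≠ b := σ.injective.ne_iff' hb
    exact ⟨σ.subtypePerm hne, mem_univ _,
      ofSubtype_subtypePerm _ fun a ha hab => ha (by rw [hab, hb])⟩
  · rw [sign_ofSubtype, prod_subtype (F := inferInstance) (univ.erase b) (p := (· ≠ b)) (by simp)]
    simp only [ofSubtype_apply_coe, submatrix_apply]

theorem permanent_eq_sum_derangements {M : Matrix α α R} (hM : ∀ a, M a a = 0) :
    M.permanent = ∑ τ : derangements α, ∏ a, M a ((τ : Perm α) a) := by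
  classical
  rw [← permanent_transpose, permanent,
    ← sum_subtype {τ : Perm α | τ ∈ derangements α} (by simp) fun τ => ∏ a, M a (τ a)]
  refine (sum_subset (subset_univ _) fun τ _ hτ => ?_).symm
  obtain ⟨a, ha⟩ : ∃ a, τ a = a := by
    by_contra! hfree
    exact hτ (mem_filter.2 ⟨mem_univ τ, hfree⟩)
  exact prod_eq_zero (mem_univ a) (by rw [ha, transpose_apply, hM])

theorem prod_apply_decomposeOption_symm (M : Matrix (Option α) (Option α) R) (b : α)
    (σ : Perm α) :
    ∏ a, M (decomposeOption.symm (some b, σ) a) a =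
      M (some b) none * M none (some (σ.symm b)) *
        ∏ a ∈ univ.erase (σ.symm b), M (some (σ a)) (some a) := by
  have hrest : ∀ a ∈ univ.erase (σ.symm b),
      M (decomposeOption.symm (some b, σ) (some a)) (some a) = M (some (σ a)) (some a) := by
    intro a ha
    have hσa : σ a ≠ b := fun h => ne_of_mem_erase ha (by simp [← h])
    simp [swap_apply_of_ne_of_ne, hσa]
  rw [Fintype.prod_option, ← mul_prod_erase univ _ (mem_univ (σ.symm b)), prod_congr rfl hrest,
    mul_assoc]
  simp

theorem signImmanant_option (χ : ℤˣ →* R) {M : Matrix (Option α) (Option α) R}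
    (hM : M none none = 0) :
    signImmanant χ M = χ (-1) * ∑ σ : Perm α, χ (sign σ) * ∑ b,
      M (some b) none * M none (some (σ.symm b)) *
        ∏ a ∈ univ.erase (σ.symm b), M (some (σ a)) (some a) := by
  rw [signImmanant, ← Equiv.sum_comp decomposeOption.symm, Fintype.sum_prod_type_right, mul_sum]
  refine sum_congr rfl fun σ _ => ?_
  have hnone : ∏ a, M (decomposeOption.symm (none, σ) a) a = 0 :=
    prod_eq_zero (mem_univ none) (by simpa using hM)
  rw [Fintype.sum_option, hnone, mul_zero, zero_add, mul_sum, mul_sum]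
  refine sum_congr rfl fun b _ => ?_
  have hsign : sign (decomposeOption.symm (some b, σ)) = -1 * sign σ := by simp
  rw [prod_apply_decomposeOption_symm, hsign, map_mul, mul_assoc]

end SignImmanant

section InvSubMatrix

variable {α K : Type*} [Field K]

/-- The matrix of inverse differences `1 / (x i - x j)`. Its diagonal vanishes because
`0⁻¹ = 0`. -/
def invSubMatrix (x : α → K) : Matrix α α K :=
  Matrix.of fun i j => (x i - x j)⁻¹

theorem invSubMatrix_apply (x : α → K) (i j : α) : invSubMatrix x i j = (x i - x j)⁻¹ :=
  rfl

theorem invSubMatrix_apply_self (x : α → K) (i : α) : invSubMatrix x i i = 0 := by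
  rw [invSubMatrix_apply, sub_self, _root_.inv_zero]

theorem inv_sub_mul_inv_sub {a b p : K} (hab : a ≠ b) (hap : a ≠ p) (hbp : b ≠ p) :
    (b - p)⁻¹ * (p - a)⁻¹ = (b - a)⁻¹ * ((p - a)⁻¹ - (p - b)⁻¹) := by
  have hba := sub_ne_zero.2 hab.symm
  have hpa := sub_ne_zero.2 hap.symm
  have hpb := sub_ne_zero.2 hbp.symm
  have hbp := sub_ne_zero.2 hbp
  field_simp
  ring

variable [Fintype α] [DecidableEq α]

/- Partial fractions turn the effect of inserting the point `none` into the cycle of `σ` through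
`b` into a term which telescopes in `b`, except when this cycle is trivial. -/
theorem prod_invSubMatrix_insert {x : Option α → K} (hx : Function.Injective x) (b : α)
    (σ : Perm α) :
    invSubMatrix x (some b) none * invSubMatrix x none (some (σ.symm b)) *
        ∏ a ∈ univ.erase (σ.symm b), invSubMatrix x (some (σ a)) (some a) =
      (if σ b = b then -((x none - x (some b))⁻¹) ^ 2 *
        ∏ a ∈ univ.erase b, invSubMatrix x (some (σ a)) (some a) else 0) +
      (∏ a, invSubMatrix x (some (σ a)) (some a)) *
        ((x none - x (some (σ.symm b)))⁻¹ - (x none - x (some b))⁻¹) := by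
  split_ifs with hb
  · have hb' : σ.symm b = b := by rw [symm_apply_eq, hb]
    rw [hb', sub_self, mul_zero, add_zero, invSubMatrix_apply, invSubMatrix_apply,
      ← neg_sub (x none), inv_neg]
    ring
  · have hb' : σ.symm b ≠ b := fun h => hb (by rw [symm_apply_eq] at h; exact h.symm)
    rw [← mul_prod_erase univ _ (mem_univ (σ.symm b)), apply_symm_apply, zero_add,
      mul_right_comm _ (∏ a ∈ _, _)]
    simp only [invSubMatrix_apply]
    rw [inv_sub_mul_inv_sub (hx.ne (by simpa using hb')) (hx.ne (by simp)) (hx.ne (by simp))]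

theorem signImmanant_invSubMatrix_option (χ : ℤˣ →* K) {x : Option α → K}
    (hx : Function.Injective x) :
    signImmanant χ (invSubMatrix x) = χ (-1) * ∑ b, -((x none - x (some b))⁻¹) ^ 2 *
      signImmanant χ (invSubMatrix fun a : {a // a ≠ b} => x (some a)) := by
  have htelescope (σ : Perm α) :
      ∑ b, ((x none - x (some (σ.symm b)))⁻¹ - (x none - x (some b))⁻¹) = 0 := by
    rw [sum_sub_distrib, Equiv.sum_comp σ.symm fun b => (x none - x (some b))⁻¹, sub_self]
  rw [signImmanant_option χ (invSubMatrix_apply_self x none)]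
  simp_rw [prod_invSubMatrix_insert hx, sum_add_distrib, ← mul_sum, htelescope, mul_zero, add_zero,
    mul_sum]
  rw [sum_comm]
  refine sum_congr rfl fun b _ => ?_
  have hfix := sum_filter_fixing_eq_signImmanant χ (invSubMatrix fun a => x (some a)) b
  rw [show (invSubMatrix fun a : {a // a ≠ b} => x (some a)) =
    (invSubMatrix fun a => x (some a)).submatrix (↑) (↑) from rfl, ← hfix, sum_filter, mul_sum,
    mul_sum]
  refine sum_congr rfl fun σ _ => ?_
  split_ifs
  · simp only [invSubMatrix_apply]
    ring
  · simp only [mul_zero]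

theorem signImmanant_invSubMatrix_eq_mul_permanent (χ : ℤˣ →* K) {m : ℕ} {x : α → K}
    (hx : Function.Injective x) (hα : Fintype.card α = 2 * m) :
    signImmanant χ (invSubMatrix x) = χ (-1) ^ m * (invSubMatrix x).permanent := by
  induction m generalizing α with
  | zero =>
    have : IsEmpty α := Fintype.card_eq_zero_iff.1 hα
    simp [signImmanant, permanent_isEmpty]
  | succ m ih =>
    obtain ⟨i⟩ : Nonempty α := Fintype.card_pos_iff.1 (by omega)
    let e := optionSubtypeNe i
    have hxe : Function.Injective (x ∘ e) := hx.comp e.injective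
    have hcard (b : {a // a ≠ i}) : Fintype.card {a // a ≠ b} = 2 * m := by
      have hi := Set.card_ne_eq i
      have hb := Set.card_ne_eq b
      simp only [Set.coe_ofPred] at hi hb
      omega
    rw [← signImmanant_one, ← signImmanant_submatrix_equiv_self χ _ e,
      ← signImmanant_submatrix_equiv_self 1 _ e,
      show (invSubMatrix x).submatrix e e = invSubMatrix (x ∘ e) from rfl,
      signImmanant_invSubMatrix_option χ hxe, signImmanant_invSubMatrix_option 1 hxe, mul_sum,
      mul_sum, mul_sum]
    refine sum_congr rfl fun b _ => ?_
    rw [ih (x := fun a : {a // a ≠ b} => (x ∘ e) (some a))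
        (hxe.comp ((Option.some_injective _).comp Subtype.val_injective)) (hcard b),
      ← signImmanant_one, MonoidHom.one_apply]
    ring

end InvSubMatrix

section CirculantMatrix

theorem trace_adjugate_units_conj {n R : Type*} [Fintype n] [DecidableEq n] [CommRing R]
    (P : (Matrix n n R)ˣ) (A : Matrix n n R) :
    trace (adjugate (P.val * A * P⁻¹.val)) = trace (adjugate A) := by
  rw [adjugate_mul_distrib, adjugate_mul_distrib, ← Matrix.mul_assoc, trace_mul_cycle,
    ← adjugate_mul_distrib, Units.inv_mul, adjugate_one, one_mul]

theorem trace_adjugate_circulant {G R : Type*} [AddGroup G] [Fintype G] [DecidableEq G]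
    [CommRing R] (v : G → R) (g : G) :
    trace (adjugate (circulant v)) = Fintype.card G * adjugate (circulant v) g g := by
  have hshift (h : G) : adjugate (circulant v) h h = adjugate (circulant v) g g := by
    let e := Equiv.addRight (-g + h)
    have hinv : (circulant v).submatrix e e = circulant v := by
      ext i j
      simp [e, circulant_apply]
    have hg : e g = h := by simp [e]
    conv_rhs => rw [← hinv, adjugate_submatrix_equiv_self, submatrix_apply, hg]
  simp [trace, hshift]

theorem circulant_mulVec_addChar {G R : Type*} [AddCommGroup G] [Fintype G] [CommRing R]
    (v : G → R) (ψ : AddChar G R) :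
    circulant v *ᵥ ψ = (∑ d, v d * ψ (-d)) • ⇑ψ := by
  ext g
  rw [mulVec_eq_sum, Finset.sum_apply, Pi.smul_apply, smul_eq_mul, sum_mul,
    ← (Equiv.subLeft g).sum_comp]
  refine sum_congr rfl fun d _ => ?_
  rw [subLeft_apply, Pi.smul_apply, transpose_apply, circulant_apply, sub_sub_cancel,
    op_smul_eq_mul, sub_eq_add_neg, AddChar.map_add_eq_mul, mul_left_comm, mul_comm]

variable {G K : Type*} [AddCommGroup G] [Fintype G] [Field K]

theorem sum_inv_one_sub_mul_pow_succ {ψ : AddChar G K} (hψ : Function.Injective ψ) {k : ℕ}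
    (hk : ψ ^ (k + 1) ≠ 1) :
    ∑ d, (1 - ψ d)⁻¹ * (ψ ^ (k + 1)) (-d) = ∑ d, (1 - ψ d)⁻¹ * (ψ ^ k) (-d) - 1 := by
  classical
  have hterm (d : G) : (1 - ψ d)⁻¹ * (ψ ^ (k + 1)) (-d) =
      (1 - ψ d)⁻¹ * (ψ ^ k) (-d) + (ψ ^ (k + 1)) (-d) - if d = 0 then 1 else 0 := by
    split_ifs with hd
    · simp [hd]
    · have hne : 1 - ψ d ≠ 0 :=
        sub_ne_zero.2 fun h => hd (hψ (h.symm.trans ψ.map_zero_eq_one.symm))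
      have hinv : ψ d * ψ (-d) = 1 := by
        rw [← AddChar.map_add_eq_mul, add_neg_cancel, AddChar.map_zero_eq_one]
      simp only [AddChar.pow_apply]
      field_simp
      linear_combination (ψ (-d)) ^ k * hinv
  have hzero : ∑ d, (ψ ^ (k + 1)) (-d) = 0 :=
    (Equiv.sum_comp (Equiv.neg G) (ψ ^ (k + 1))).trans (AddChar.sum_eq_zero_of_ne_one hk)
  rw [sum_congr rfl fun d _ => hterm d, sum_sub_distrib, sum_add_distrib, hzero, add_zero]
  simp

theorem sum_inv_one_sub_mul_pow {ψ : AddChar G K} (hψ : Function.Injective ψ) {k : ℕ}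
    (hk : k < orderOf ψ) :
    ∑ d, (1 - ψ d)⁻¹ * (ψ ^ k) (-d) = ∑ d, (1 - ψ d)⁻¹ - k := by
  induction k with
  | zero => simp
  | succ k ih =>
    rw [sum_inv_one_sub_mul_pow_succ hψ (pow_ne_one_of_lt_orderOf k.succ_ne_zero hk),
      ih (by omega)]
    push_cast
    ring

end CirculantMatrix

section RootMatrix

variable {K : Type*} [Field K] {ζ : K} {n : ℕ}

/-- The matrix with entries `1 / (1 - ζ ^ (j - l))`, with an integer exponent, whose permanent is
the sum over derangements to be computed. Its diagonal vanishes because `1 / 0 = 0`. -/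
def rootMatrix (ζ : K) (n : ℕ) : Matrix (Fin n) (Fin n) K :=
  Matrix.of fun j l => 1 / (1 - ζ ^ (((j : ℕ) : ℤ) - ((l : ℕ) : ℤ)))

/-- The additive character `d ↦ ζ ^ d` of `ℤ/n`, with `ℤ/n` realised as `Fin n` to match the
indices of `rootMatrix`. -/
def rootAddChar [NeZero n] (hζ : ζ ^ n = 1) : AddChar (Fin n) K where
  toFun d := ζ ^ (d : ℕ)
  map_zero_eq_one' := by simp
  map_add_eq_mul' a b := by rw [Fin.val_add, ← pow_eq_pow_mod _ hζ, pow_add]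

theorem rootAddChar_apply [NeZero n] (hζ : ζ ^ n = 1) (d : Fin n) :
    rootAddChar hζ d = ζ ^ (d : ℕ) :=
  rfl

theorem rootAddChar_injective [NeZero n] (hζ : IsPrimitiveRoot ζ n) :
    Function.Injective (rootAddChar hζ.pow_eq_one) :=
  fun i j h => Fin.ext (hζ.pow_inj i.2 j.2 h)

theorem orderOf_rootAddChar [NeZero n] (hζ : IsPrimitiveRoot ζ n) :
    orderOf (rootAddChar hζ.pow_eq_one) = n := by
  refine (orderOf_eq_orderOf_iff.2 fun k => ?_).trans hζ.eq_orderOf.symm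
  rw [AddChar.eq_one_iff]
  refine ⟨fun h => ?_, fun h d => ?_⟩
  · simpa [rootAddChar_apply, Fin.val_one', ← pow_eq_pow_mod 1 hζ.pow_eq_one] using h 1
  · rw [AddChar.pow_apply, rootAddChar_apply, pow_right_comm, h, one_pow]

theorem rootMatrix_eq_circulant [NeZero n] (hζ : ζ ^ n = 1) :
    rootMatrix ζ n = circulant fun d => (1 - rootAddChar hζ d)⁻¹ := by
  have hζ0 : ζ ≠ 0 := (IsUnit.of_pow_eq_one hζ (NeZero.ne n)).ne_zero
  ext j l
  rw [circulant_apply, AddChar.map_sub_eq_div, rootAddChar_apply, rootAddChar_apply, rootMatrix,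
    of_apply, one_div, zpow_sub₀ hζ0, zpow_natCast, zpow_natCast]

theorem trace_rootMatrix (ζ : K) (n : ℕ) : (rootMatrix ζ n).trace = 0 := by
  simp [trace, rootMatrix]

theorem exists_rootMatrix_eq_conj_diagonal_sub [NeZero n] (hζ : IsPrimitiveRoot ζ n) :
    ∃ (c : K) (P : (Matrix (Fin n) (Fin n) K)ˣ),
      rootMatrix ζ n = P.val * diagonal (fun k : Fin n => c - (k : ℕ)) * P⁻¹.val := by
  let ψ := rootAddChar hζ.pow_eq_one
  let P := (vandermonde ψ).nonsingInvUnit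
    (det_vandermonde_ne_zero_iff.2 (rootAddChar_injective hζ)).isUnit
  refine ⟨∑ d, (1 - ψ d)⁻¹, P, (Units.eq_mul_inv_iff_mul_eq P).2 ?_⟩
  ext j k
  have hk := congrFun (circulant_mulVec_addChar (fun d => (1 - ψ d)⁻¹) (ψ ^ (k : ℕ))) j
  rw [sum_inv_one_sub_mul_pow (rootAddChar_injective hζ)
    (by rw [orderOf_rootAddChar hζ]; exact k.2), Pi.smul_apply, smul_eq_mul, mul_comm] at hk
  rw [mul_diagonal, rootMatrix_eq_circulant hζ.pow_eq_one]
  exact hk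

/- The common offset of the eigenvalues is found from the trace, which is zero. -/
theorem exists_rootMatrix_eq_conj_diagonal [NeZero n] (hζ : IsPrimitiveRoot ζ n) :
    ∃ P : (Matrix (Fin n) (Fin n) K)ˣ, rootMatrix ζ n =
      P.val * diagonal (fun k : Fin n => (n.choose 2 : K) / n - (k : ℕ)) * P⁻¹.val := by
  obtain ⟨c, P, hP⟩ := exists_rootMatrix_eq_conj_diagonal_sub hζ
  have hn : (n : K) ≠ 0 := hζ.neZero'.ne
  have hsum : ∑ k : Fin n, ((k : ℕ) : K) = n.choose 2 := by
    rw [Fin.sum_univ_eq_sum_range (fun k => (k : K)), ← Nat.cast_sum, sum_range_id,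
      Nat.choose_two_right]
  have htrace : n * c - n.choose 2 = 0 := by
    rw [← trace_rootMatrix ζ n, hP, trace_units_conj, trace_diagonal, sum_sub_distrib, hsum]
    simp
  have hc : c = n.choose 2 / n := by
    rw [eq_div_iff hn]
    linear_combination htrace
  exact ⟨P, hc ▸ hP⟩

theorem det_rootMatrix [NeZero n] (hζ : IsPrimitiveRoot ζ n) :
    (rootMatrix ζ n).det = ∏ k ∈ range n, ((n.choose 2 : K) / n - k) := by
  obtain ⟨P, hP⟩ := exists_rootMatrix_eq_conj_diagonal hζ
  rw [hP, det_units_conj, det_diagonal,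
    Fin.prod_univ_eq_prod_range fun k => (n.choose 2 : K) / n - k]

theorem trace_adjugate_rootMatrix_succ (hζ : ζ ^ (n + 1) = 1) :
    (adjugate (rootMatrix ζ (n + 1))).trace = (n + 1 : ℕ) * (rootMatrix ζ n).det := by
  rw [rootMatrix_eq_circulant hζ, trace_adjugate_circulant _ (Fin.last n),
    ← rootMatrix_eq_circulant hζ, adjugate_fin_succ_eq_det_submatrix, ← two_mul, pow_mul,
    neg_one_sq, one_pow, one_mul, Fintype.card_fin, Fin.succAbove_last]
  rfl

/- The eigenvalue with index `m` vanishes, so only one term of the trace of the adjugate of the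
diagonalization survives. -/
theorem det_rootMatrix_two_mul_of_odd {m : ℕ} (hζ : IsPrimitiveRoot ζ (2 * m + 1)) :
    (2 * m + 1 : ℕ) * (rootMatrix ζ (2 * m)).det =
      ∏ k ∈ (range (2 * m + 1)).erase m, ((m : K) - k) := by
  obtain ⟨P, hP⟩ := exists_rootMatrix_eq_conj_diagonal hζ
  have hmean : ((2 * m + 1).choose 2 : K) / (2 * m + 1 : ℕ) = m := by
    rw [div_eq_iff hζ.neZero'.ne, Nat.choose_two_right, Nat.add_sub_cancel, mul_left_comm,
      Nat.mul_div_cancel_left _ two_pos]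
    push_cast
    ring
  let mid : Fin (2 * m + 1) := ⟨m, by omega⟩
  have hmap : (univ.erase mid).map Fin.valEmbedding = (range (2 * m + 1)).erase m := by
    rw [map_erase, Fin.map_valEmbedding_univ, Nat.Iio_eq_range]
    rfl
  rw [← trace_adjugate_rootMatrix_succ hζ.pow_eq_one, hP, trace_adjugate_units_conj,
    adjugate_diagonal, trace_diagonal, hmean, ← hmap, prod_map, Fintype.sum_eq_single mid]
  · rfl
  · intro i hi
    exact prod_eq_zero (mem_erase.2 ⟨hi.symm, mem_univ mid⟩) (sub_self _)

end RootMatrix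

section Products

open scoped Nat

variable {K : Type*} [Field K]

theorem prod_range_two_mul_half_sub (h2 : (2 : K) ≠ 0) (m : ℕ) :
    ∏ k ∈ range (2 * m), ((2 * m - 1 : K) / 2 - k) =
      (-1) ^ m * (((2 * m - 1)‼ : K) ^ 2 / 2 ^ (2 * m)) := by
  induction m with
  | zero => simp
  | succ m ih =>
    have hfact : (2 * (m + 1) - 1)‼ = (2 * m + 1) * (2 * m - 1)‼ :=
      Nat.doubleFactorial_add_one (2 * m)
    have hshift : ∀ k ∈ range (2 * m), (2 * (m + 1 : ℕ) - 1 : K) / 2 - (k + 1 : ℕ) =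
        (2 * m - 1) / 2 - k := fun k _ => by
      push_cast
      field_simp
      ring
    rw [hfact, show 2 * (m + 1) = 2 * m + 1 + 1 by ring, prod_range_succ, prod_range_succ',
      prod_congr rfl hshift, ih]
    push_cast
    field_simp
    ring

theorem prod_range_erase_sub (R : Type*) [CommRing R] (m : ℕ) :
    ∏ k ∈ (range (2 * m + 1)).erase m, ((m : R) - k) = (-1) ^ m * (m ! : R) ^ 2 := by
  have hsplit : (range (2 * m + 1)).erase m = range m ∪ Ico (m + 1) (2 * m + 1) := by
    ext k
    simp only [mem_erase, mem_range, mem_union, mem_Ico]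
    omega
  have hdisj : Disjoint (range m) (Ico (m + 1) (2 * m + 1)) := by
    rw [disjoint_left]
    simp only [mem_range, mem_Ico]
    omega
  have hlow : ∏ k ∈ range m, ((m : R) - k) = m ! := by
    rw [← Nat.descFactorial_self, Nat.descFactorial_eq_prod_range, Nat.cast_prod]
    exact prod_congr rfl fun k hk => (Nat.cast_sub (mem_range.1 hk).le).symm
  have hhigh : ∏ k ∈ Ico (m + 1) (2 * m + 1), ((m : R) - k) = (-1) ^ m * m ! := by
    rw [prod_Ico_eq_prod_range, show 2 * m + 1 - (m + 1) = m by omega,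
      ← prod_range_add_one_eq_factorial, Nat.cast_prod, ← card_range m, ← prod_const, card_range,
      ← prod_mul_distrib]
    exact prod_congr rfl fun k _ => by push_cast; ring
  rw [hsplit, prod_union hdisj, hlow, hhigh]
  ring

theorem factorial_two_mul_eq_mul_doubleFactorial (m : ℕ) :
    (2 * m)! = 2 ^ m * m ! * (2 * m - 1)‼ := by
  rw [← Nat.doubleFactorial_two_mul]
  cases m with
  | zero => rfl
  | succ m => exact Nat.factorial_eq_mul_doubleFactorial (2 * m + 1)

theorem choose_two_mul_mul_factorial (m : ℕ) :
    (2 * m).choose m * m ! = 2 ^ m * (2 * m - 1)‼ := by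
  apply Nat.eq_of_mul_eq_mul_right m.factorial_pos
  have h := Nat.choose_mul_factorial_mul_factorial (Nat.le_mul_of_pos_left m two_pos)
  rw [show 2 * m - m = m by omega, factorial_two_mul_eq_mul_doubleFactorial] at h
  rw [h]
  ring

theorem doubleFactorial_sq_mul_four_pow (m : ℕ) :
    (2 * m - 1)‼ ^ 2 * 4 ^ m = (2 * m)! * (2 * m).choose m := by
  rw [factorial_two_mul_eq_mul_doubleFactorial, mul_right_comm, mul_assoc (2 ^ m),
    mul_comm m !, choose_two_mul_mul_factorial, show 4 = 2 ^ 2 by rfl, ← pow_mul]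
  ring

theorem doubleFactorial_sq_div_two_pow (h2 : (2 : K) ≠ 0) (m : ℕ) :
    ((2 * m - 1)‼ : K) ^ 2 / 2 ^ (2 * m) =
      ((2 * m)! : K) / 4 ^ (2 * m) * ((2 * m).choose m : K) := by
  have hcast := congrArg (Nat.cast : ℕ → K) (doubleFactorial_sq_mul_four_pow m)
  push_cast at hcast
  have h4 : (4 : K) = 2 ^ 2 := by norm_num
  have hpow : (4 : K) ^ (2 * m) = 2 ^ (2 * m) * 4 ^ m := by
    rw [h4, ← pow_mul, ← pow_mul]
    ring
  rw [div_mul_eq_mul_div, ← hcast, hpow, mul_div_mul_right]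
  exact h4 ▸ pow_ne_zero m (pow_ne_zero 2 h2)

end Products

section Permanent

open scoped Nat

variable {K : Type*} [Field K] {ζ : K} {m n : ℕ}

theorem rootMatrix_eq_invSubMatrix_mul_diagonal (hζ : ζ ≠ 0) (n : ℕ) :
    rootMatrix ζ n = invSubMatrix (fun j : Fin n => ζ ^ (j : ℕ)) *
      diagonal fun l : Fin n => -ζ ^ (l : ℕ) := by
  ext j l
  have hl : ζ ^ (l : ℕ) ≠ 0 := pow_ne_zero _ hζ
  have hsub : 1 - ζ ^ (j : ℕ) / ζ ^ (l : ℕ) =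
      (ζ ^ (j : ℕ) - ζ ^ (l : ℕ)) * (-ζ ^ (l : ℕ))⁻¹ := by
    field_simp
    ring
  rw [mul_diagonal, invSubMatrix_apply, rootMatrix, of_apply, zpow_sub₀ hζ, zpow_natCast,
    zpow_natCast, hsub, one_div, _root_.mul_inv, inv_inv]

theorem det_rootMatrix_eq_mul_permanent (hζ : ζ ≠ 0)
    (hinj : Function.Injective fun j : Fin (2 * m) => ζ ^ (j : ℕ)) :
    (rootMatrix ζ (2 * m)).det = (-1) ^ m * (rootMatrix ζ (2 * m)).permanent := by
  rw [← signImmanant_intCast, ← signImmanant_one, rootMatrix_eq_invSubMatrix_mul_diagonal hζ,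
    signImmanant_mul_diagonal, signImmanant_mul_diagonal,
    signImmanant_invSubMatrix_eq_mul_permanent _ hinj (Fintype.card_fin _), signImmanant_one]
  simp [mul_assoc]

theorem permanent_rootMatrix_eq_mul_det [NeZero n] (hζ : IsPrimitiveRoot ζ n) (hm : 2 * m ≤ n) :
    (rootMatrix ζ (2 * m)).permanent = (-1) ^ m * (rootMatrix ζ (2 * m)).det := by
  have hinj : Function.Injective fun j : Fin (2 * m) => ζ ^ (j : ℕ) := fun i j h =>
    Fin.ext (hζ.pow_inj (i.2.trans_le hm) (j.2.trans_le hm) h)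
  rw [det_rootMatrix_eq_mul_permanent (hζ.ne_zero (NeZero.ne n)) hinj, ← mul_assoc, ← mul_pow,
    neg_one_mul, neg_neg, one_pow, one_mul]

theorem two_ne_zero_of_isPrimitiveRoot_two_mul [NeZero (2 * m)] (hζ : IsPrimitiveRoot ζ (2 * m)) :
    (2 : K) ≠ 0 := by
  have hn : ((2 * m : ℕ) : K) ≠ 0 := hζ.neZero'.ne
  exact left_ne_zero_of_mul (by rwa [Nat.cast_mul, Nat.cast_two] at hn)

theorem permanent_rootMatrix_two_mul [NeZero (2 * m)] (hζ : IsPrimitiveRoot ζ (2 * m)) :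
    (rootMatrix ζ (2 * m)).permanent = ((2 * m - 1)‼ : K) ^ 2 / 2 ^ (2 * m) := by
  have hn : ((2 * m : ℕ) : K) ≠ 0 := hζ.neZero'.ne
  have h2 : (2 : K) ≠ 0 := two_ne_zero_of_isPrimitiveRoot_two_mul hζ
  have hmean : ((2 * m).choose 2 : K) / (2 * m : ℕ) = (2 * m - 1) / 2 := by
    have hpos : 1 ≤ 2 * m := NeZero.one_le
    rw [div_eq_div_iff hn h2, Nat.choose_two_right, mul_assoc, Nat.mul_div_cancel_left _ two_pos]
    push_cast [hpos]
    ring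
  rw [permanent_rootMatrix_eq_mul_det hζ le_rfl, det_rootMatrix hζ, hmean,
    prod_range_two_mul_half_sub h2, ← mul_assoc, ← mul_pow, neg_one_mul, neg_neg, one_pow, one_mul]

theorem permanent_rootMatrix_two_mul_of_odd (hζ : IsPrimitiveRoot ζ (2 * m + 1)) :
    (rootMatrix ζ (2 * m)).permanent = 1 / (2 * m + 1 : ℕ) * (m ! : K) ^ 2 := by
  have hn : ((2 * m + 1 : ℕ) : K) ≠ 0 := hζ.neZero'.ne
  have hdet := det_rootMatrix_two_mul_of_odd hζ
  rw [prod_range_erase_sub] at hdet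
  rw [permanent_rootMatrix_eq_mul_det hζ (Nat.le_succ _), one_div, eq_inv_mul_iff_mul_eq₀ hn,
    mul_left_comm, hdet, ← mul_assoc, ← mul_pow, neg_one_mul, neg_neg, one_pow, one_mul]

theorem permanent_rootMatrix_eq_sum_derangements (ζ : K) (n : ℕ) :
    (rootMatrix ζ n).permanent = ∑ τ : derangements (Fin n), ∏ j : Fin n,
      1 / (1 - ζ ^ (((j : ℕ) : ℤ) - (((τ : Perm (Fin n)) j : ℕ) : ℤ))) :=
  permanent_eq_sum_derangements fun j => by simp [rootMatrix]

theorem mainTheorem2_general [NeZero n] (hζ : IsPrimitiveRoot ζ n) :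
    (Even n →
      ∑ τ : derangements (Fin n), ∏ j : Fin n,
        1 / (1 - ζ ^ (((j : ℕ) : ℤ) - (((τ : Perm (Fin n)) j : ℕ) : ℤ))) =
          ((n - 1)‼ : K) ^ 2 / 2 ^ n ∧
      ((n - 1)‼ : K) ^ 2 / 2 ^ n = (n ! : K) / 4 ^ n * (n.choose (n / 2) : K)) ∧
    (Odd n →
      ∑ τ : derangements (Fin (n - 1)), ∏ j : Fin (n - 1),
        1 / (1 - ζ ^ (((j : ℕ) : ℤ) - (((τ : Perm (Fin (n - 1))) j : ℕ) : ℤ))) =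
          1 / (n : K) * (((n - 1) / 2)! : K) ^ 2) := by
  simp only [← permanent_rootMatrix_eq_sum_derangements]
  refine ⟨fun heven => ?_, fun hodd => ?_⟩
  · obtain ⟨m, rfl⟩ := heven.two_dvd
    rw [Nat.mul_div_cancel_left m two_pos]
    exact ⟨permanent_rootMatrix_two_mul hζ,
      doubleFactorial_sq_div_two_pow (two_ne_zero_of_isPrimitiveRoot_two_mul hζ) m⟩
  · obtain ⟨m, rfl⟩ := hodd
    rw [Nat.add_sub_cancel, Nat.mul_div_cancel_left m two_pos]
    exact permanent_rootMatrix_two_mul_of_odd hζ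

end Permanent

theorem mainTheorem2 (n : ℕ) (hn : 1 < n) (ζ : ℂ) (hζ : IsPrimitiveRoot ζ n) :
    (Even n →
      derangementSum ζ n = ((Nat.doubleFactorial (n - 1) : ℕ) : ℂ) ^ 2 / 2 ^ n ∧
      ((Nat.doubleFactorial (n - 1) : ℕ) : ℂ) ^ 2 / 2 ^ n =
        ((Nat.factorial n : ℕ) : ℂ) / 4 ^ n * ((Nat.choose n (n / 2) : ℕ) : ℂ)) ∧
    (Odd n →
      derangementSum ζ (n - 1) =
        1 / (n : ℂ) * ((Nat.factorial ((n - 1) / 2) : ℕ) : ℂ) ^ 2) := by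
  have : NeZero n := ⟨by omega⟩
  exact mainTheorem2_general hζ
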